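/- Let $E$ be a countable set and let $r(x,y)\ge 0$ ($x\neq y\in E$) be the jump rates of an irreducible continuous-time Markov chain $X_t$ on $E$, with finite holding rates $\lambda(x)=\sum_{y\ne x} r(x,y)$. Let $\mu$ be a stationary measure: $\mu:E\to[0,\infty)$ is not identically zero and $\sum_y \mu(y)r(y,x)=\mu(x)\lambda(x)$ for all $x\in E$ (the total mass of $\mu$ may be infinite). The time-reversed process $X^*_t$ is the chain with jump rates $r^*(x,y)=\mu(y)r(y,x)/\mu(x)$. (Neither chain is assumed to be non-explosive; a chain which explodes is sent to a cemetery at its explosion time.) Write $\mathbb P_x$, $\mathbb P^*_x$ for the laws of $X_t$, $X_t^*$ started at $x$, and $$(Lf)(x)=\sum_y r(x,y)[f(y)-f(x)],\quad (L^*f)(x)=\sum_y r^*(x,y)[f(y)-f(x)],\quad S=\tfrac12(L+L^*),\quad \langle f,g\rangle_\mu=\sum_x\mu(x)f(x)g(x).$$ For $C\subset E$ let $T_C=\inf\{s>0: X_s\in C\}$ and $T_C^+=\inf\{t>0: X_t\in C,\ X_s\ne X_0\text{ for some }0<s<t\}$. For disjoint $A,B\subset E$ set $$\mathrm{Cap}(A,B)=\sum_{x\in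 A}\mu(x)\lambda(x)\,\mathbb P_x[T_A^+>T_B^+],\qquad V_{A,B}(x)=\mathbb P_x[T_A<T_B],\qquad V^*_{A,B}(x)=\mathbb P^*_x[T_A<T_B].$$ Theorem. Let $A,B\subset E$ be disjoint with $B^c$ finite. Then $$\mathrm{Cap}(A,B)=\inf_F\,\sup_H\big\{2\langle L^*F,H\rangle_\mu-\langle H,(-S)H\rangle_\mu\big\},$$ where the infimum is over all functions $F:E\to\mathbb R$ equal to $1$ on $A$ and to $0$ on $B$, and the supremum is over all functions $H:E\to\mathbb R$ that are constant on $A$ and constant on $B$; for all such $F$ and $H$ the sums over $E$ defining the two scalar products converge absolutely. Moreover, the infimum over $F$ is attained at $$F_{A,B}=\tfrac12\big(V_{A,B}+V^*_{A,B}\big),$$ and, if $A\cup B\neq\varnothing$, at no other admissible $F$. -/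

import Mathlib

open MeasureTheory ProbabilityTheory
open scoped NNReal ENNReal

namespace MarkovDirichlet

noncomputable section

/-- Jump rates `r x y` (for `x ≠ y`) of a continuous-time Markov chain on `E`, with finite holding
rates. The diagonal is set to zero. -/
structure JumpRates (E : Type*) where
  rate : E → E → ℝ≥0
  rate_self : ∀ x, rate x x = 0
  summable_rate : ∀ x, Summable (rate x)

namespace JumpRates

variable {E : Type*}

/-- The holding rate `λ(x) = ∑_y r(x, y)`. -/
def holdingRate (r : JumpRates E) (x : E) : ℝ≥0 := ∑' y, r.rate x y

/-- Every state can be reached from every state by jumps of positive rate. -/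
def Irreducible (r : JumpRates E) : Prop :=
  ∀ x y : E, Relation.ReflTransGen (fun u v => 0 < r.rate u v) x y

/-- A stationary measure, given by its point masses (its total mass may be infinite):
it is nonzero and satisfies `∑_y μ(y) r(y, x) = μ(x) λ(x)` for every `x`. -/
structure IsStationary (r : JumpRates E) (μ : E → ℝ≥0) : Prop where
  ne_zero : μ ≠ 0
  balance : ∀ x, HasSum (fun y => μ y * r.rate y x) (μ x * r.holdingRate x)

/-- Jump rates of the time-reversed process: `r*(x, y) = μ(y) r(y, x) / μ(x)`. -/
def adjoint (r : JumpRates E) (μ : E → ℝ≥0) (h : r.IsStationary μ) : JumpRates E where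
  rate x y := μ y * r.rate y x / μ x
  rate_self x := by simp [r.rate_self x]
  summable_rate x := (h.balance x).summable.div_const (μ x)

/-- The generator `(L f)(x) = ∑_y r(x, y) (f(y) - f(x))`. -/
def generator (r : JumpRates E) (f : E → ℝ) (x : E) : ℝ :=
  ∑' y, (r.rate x y : ℝ) * (f y - f x)

open Classical in
/-- The jump probabilities `p(x, ·) = r(x, ·) / λ(x)`. For an absorbing state `x` (`λ(x) = 0`)
the value is irrelevant, as the holding time at `x` is infinite. -/
def jumpPMF (r : JumpRates E) (x : E) : PMF E :=
  if h : ∑' y, (r.rate x y : ℝ≥0∞) = 0 then PMF.pure x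
  else PMF.normalize (fun y => (r.rate x y : ℝ≥0∞)) h
    (ENNReal.tsum_coe_ne_top_iff_summable.2 (r.summable_rate x))

/-- The sample space: the sequence of visited states, and a sequence of clocks, which will be
independent standard exponential variables. -/
abbrev Sample (E : Type*) : Type _ := (ℕ → E) × (ℕ → ℝ)

/-- The holding time in the `n`-th visited state `y`: the `n`-th clock divided by `λ(y)`.
It is infinite if `λ(y) = 0`. -/
def holdingTime (r : JumpRates E) (ω : Sample E) (n : ℕ) : ℝ≥0∞ :=
  ENNReal.ofReal (ω.2 n) / r.holdingRate (ω.1 n)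

/-- The time of the `n`-th jump (with the convention that the zeroth one occurs at time `0`). -/
def jumpTime (r : JumpRates E) (ω : Sample E) (n : ℕ) : ℝ≥0∞ :=
  ∑ k ∈ Finset.range n, r.holdingTime ω k

open Classical in
/-- The position `X_t`: the `n`-th visited state for `t` between the `n`-th and the `(n+1)`-st
jump time, and the cemetery `none` from the explosion time on, if there is an explosion. -/
def position (r : JumpRates E) (ω : Sample E) (t : ℝ≥0) : Option E :=
  if h : ∃ n, r.jumpTime ω n ≤ t ∧ t < r.jumpTime ω (n + 1) then some (ω.1 (Nat.find h)) else none

/-- The hitting time `T_A = inf {t > 0 : X_t ∈ A}`, equal to `∞` if there is no such time. -/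
def hittingTime (r : JumpRates E) (A : Set E) (ω : Sample E) : ℝ≥0∞ :=
  ⨅ (t : ℝ≥0) (_ : 0 < t ∧ ∃ a ∈ A, r.position ω t = some a), (t : ℝ≥0∞)

/-- The return time `T_A⁺ = inf {t > 0 : X_t ∈ A, X_s ≠ X_0 for some 0 < s < t}`. -/
def returnTime (r : JumpRates E) (A : Set E) (ω : Sample E) : ℝ≥0∞ :=
  ⨅ (t : ℝ≥0) (_ : 0 < t ∧ (∃ a ∈ A, r.position ω t = some a) ∧
    ∃ s : ℝ≥0, 0 < s ∧ s < t ∧ r.position ω s ≠ r.position ω 0), (t : ℝ≥0∞)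

variable [Countable E] [MeasurableSpace E] [DiscreteMeasurableSpace E]

/-- The transition kernel of the embedded discrete-time jump chain. -/
def jumpKernel (r : JumpRates E) : Kernel E E :=
  Kernel.ofFunOfCountable fun x => (r.jumpPMF x).toMeasure

instance (r : JumpRates E) : IsMarkovKernel r.jumpKernel :=
  ⟨fun x => inferInstanceAs (IsProbabilityMeasure (r.jumpPMF x).toMeasure)⟩

/-- The law of the embedded jump chain started at `x`. -/
def jumpChainLaw (r : JumpRates E) (x : E) : Measure (ℕ → E) :=
  Kernel.trajMeasure (X := fun _ => E) (Measure.dirac x) fun n =>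
    r.jumpKernel.comap (fun y : (i : Finset.Iic n) → E => y ⟨n, Finset.mem_Iic.2 le_rfl⟩)
      (measurable_pi_apply _)

/-- The law `P_x` of the process started at `x`: the jump chain together with an independent
sequence of independent exponential clocks of parameter one. -/
def law (r : JumpRates E) (x : E) : Measure (Sample E) :=
  (r.jumpChainLaw x).prod (Measure.infinitePi fun _ : ℕ => expMeasure 1)

/-- The equilibrium potential `V_{A,B}(x) = P_x[T_A < T_B]`. -/
def equilibriumPotential (r : JumpRates E) (A B : Set E) (x : E) : ℝ :=
  (r.law x).real {ω | r.hittingTime A ω < r.hittingTime B ω}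

/-- The capacity `Cap(A, B) = ∑_{x ∈ A} μ(x) λ(x) P_x[T_A⁺ > T_B⁺]`, with values in `[0, ∞]`. -/
def capacity (r : JumpRates E) (μ : E → ℝ≥0) (A B : Set E) : ℝ≥0∞ :=
  ∑' x : A, ((μ x * r.holdingRate x : ℝ≥0) : ℝ≥0∞) *
    r.law x {ω | r.returnTime A ω > r.returnTime B ω}

end JumpRates

variable {E : Type*}

/-- The pairing `⟨f, g⟩_μ = ∑_x μ(x) f(x) g(x)`. -/
def pairing (μ : E → ℝ≥0) (f g : E → ℝ) : ℝ := ∑' x, (μ x : ℝ) * f x * g x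

/-- The symmetric part `S = (L + L*) / 2` of the generator. -/
def symmGenerator (r : JumpRates E) (μ : E → ℝ≥0) (h : r.IsStationary μ) (f : E → ℝ) (x : E) : ℝ :=
  (r.generator f x + (r.adjoint μ h).generator f x) / 2

/-- The functions equal to `1` on `A` and to `0` on `B`. -/
def boundaryFunctions (A B : Set E) : Set (E → ℝ) :=
  {F | (∀ x ∈ A, F x = 1) ∧ ∀ x ∈ B, F x = 0}

/-- The functions that are constant on `A` and constant on `B`. -/
def testFunctions (A B : Set E) : Set (E → ℝ) :=
  {H | (∃ c, ∀ x ∈ A, H x = c) ∧ ∃ c, ∀ x ∈ B, H x = c}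

/-- The expression `2 ⟨L* F, H⟩_μ - ⟨H, (-S) H⟩_μ`. -/
def dirichletFunctional (r : JumpRates E) (μ : E → ℝ≥0) (h : r.IsStationary μ)
    (F H : E → ℝ) : ℝ :=
  2 * pairing μ ((r.adjoint μ h).generator F) H
    - pairing μ H (fun x => -symmGenerator r μ h H x)

/-- The supremum over `H` of `2 ⟨L* F, H⟩_μ - ⟨H, (-S) H⟩_μ`, in the extended reals. -/
def supFunctional (r : JumpRates E) (μ : E → ℝ≥0) (h : r.IsStationary μ) (A B : Set E)
    (F : E → ℝ) : EReal :=
  ⨆ H ∈ testFunctions A B, (dirichletFunctional r μ h F H : EReal)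

end

end MarkovDirichlet

/-! Write `a(F, H) = ⟨L* F, H⟩_μ`, `V = V_{A,B}` and `W = V*_{A,B}`. Functions constant on `B` are,
up to an additive constant, finitely supported, and generators kill constants. Hence infinite mass
and explosion cause no trouble: `a` is bilinear on such functions, `⟨L F, H⟩_μ = a(H, F)`
(`form_eq_form_adjoint`) and `a(H, H) ≤ 0` (`form_self_nonpos`). The functional is therefore `2 a(F,
H) + a(H, H)`.

Lower bound: `a(F, V) = ⟨L V, F⟩_μ` depends only on the boundary values of `F`, because `L V = 0`
off `A ∪ B`; so it equals `a(V, V)`, and `H = -V` gives the value `-a(V, V)` for every admissible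
`F`. Attainment: harmonicity of both potentials gives `a(W, H) = a(H, V)` for test functions, so at
`F = (V + W)/2` the functional is `a(V + H, V + H) - a(V, V) ≤ -a(V, V)`. Uniqueness: for a
minimizer `F`, the first variation at `H = -V` vanishes; point masses off `A ∪ B` then show that `L*
F` is determined there, and the maximum principle determines `F`.

The value `-a(V, V)` is the capacity (`capacity_eq`). This is the probabilistic half: comparisons of
hitting times become events of the jump chain, first-step analysis makes `V` harmonic, and the
maximum principle shows that the chain cannot avoid `A ∪ B`. -/

namespace MarkovDirichlet

namespace JumpRates

/-! ### The law of the jump chain and its Markov property -/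

section Chain

variable {E : Type*}

/-- The paths that agree with `e` up to time `n`. -/
def pathCylinder (e : ℕ → E) (n : ℕ) : Set (ℕ → E) := {ω | ∀ i ≤ n, ω i = e i}

/-- The path without its first state. -/
def pathShift (ω : ℕ → E) : ℕ → E := fun n => ω (n + 1)

/-- The path with one more state in front. -/
def pathCons (x : E) (e : ℕ → E) : ℕ → E
  | 0 => x
  | n + 1 => e n

lemma pathCylinder_eq_preimage (e : ℕ → E) (n : ℕ) :
    pathCylinder e n = Preorder.frestrictLe (π := fun _ => E) n ⁻¹'
      {Preorder.frestrictLe (π := fun _ => E) n e} := by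
  ext ω
  simp [pathCylinder, funext_iff]

lemma measurable_pathShift [MeasurableSpace E] : Measurable (pathShift : (ℕ → E) → ℕ → E) :=
  measurable_pi_lambda _ fun n => measurable_pi_apply (n + 1)

lemma measurableSet_pathCylinder [MeasurableSpace E] [DiscreteMeasurableSpace E]
    (e : ℕ → E) (n : ℕ) : MeasurableSet (pathCylinder e n) := by
  have : pathCylinder e n = ⋂ i, ⋂ (_ : i ≤ n), (fun ω : ℕ → E => ω i) ⁻¹' {e i} := by
    ext ω; simp [pathCylinder]
  rw [this]
  exact .iInter fun i => .iInter fun _ => measurable_pi_apply i (.of_discrete)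

variable [Countable E] [MeasurableSpace E] [DiscreteMeasurableSpace E]

/-- Finite measures on the path space are determined by the paths of finite length. -/
lemma measure_ext_pathCylinder {P Q : Measure (ℕ → E)} [IsFiniteMeasure P] [IsFiniteMeasure Q]
    (h : ∀ e n, P (pathCylinder e n) = Q (pathCylinder e n)) : P = Q := by
  have hn : ∀ n, P.map (Preorder.frestrictLe (π := fun _ => E) n) =
      Q.map (Preorder.frestrictLe (π := fun _ => E) n) := by
    intro n
    refine Measure.ext_of_singleton fun a => ?_
    rw [Measure.map_apply (Preorder.measurable_frestrictLe n) (measurableSet_singleton _),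
      Measure.map_apply (Preorder.measurable_frestrictLe n) (measurableSet_singleton _)]
    by_cases ha : ∃ e, Preorder.frestrictLe (π := fun _ => E) n e = a
    · obtain ⟨e, rfl⟩ := ha
      rw [← pathCylinder_eq_preimage, h]
    · have : Preorder.frestrictLe (π := fun _ => E) n ⁻¹' {a} = ∅ := by
        ext ω
        simpa using fun hω => ha ⟨ω, hω⟩
      rw [this, measure_empty, measure_empty]
  -- Every finite set of indices lies in an initial segment, so the marginals on initial segments
  -- suffice.
  refine IsProjectiveLimit.unique (P := fun I => Q.map I.restrict) (fun I => ?_) (fun I => rfl)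
  have hI := I.subset_Iic_sup_id
  change P.map I.restrict = Q.map I.restrict
  rw [← Finset.restrict₂_comp_restrict hI,
    ← Measure.map_map (Finset.measurable_restrict₂ _) (Finset.measurable_restrict _),
    ← Measure.map_map (Finset.measurable_restrict₂ _) (Finset.measurable_restrict _)]
  exact congrArg _ (hn _)

instance (r : JumpRates E) (x : E) : IsProbabilityMeasure (r.jumpChainLaw x) := by
  rw [jumpChainLaw]; infer_instance

lemma jumpChainLaw_map_eval_zero (r : JumpRates E) (x : E) :
    (r.jumpChainLaw x).map (fun ω => ω 0) = Measure.dirac x := by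
  have h0 : (fun ω : ℕ → E => ω 0) =
      (fun y : (i : Finset.Iic 0) → E => y ⟨0, Finset.mem_Iic.2 le_rfl⟩) ∘
        Preorder.frestrictLe (π := fun _ => E) 0 := rfl
  rw [h0, ← Measure.map_map (g := fun y : (i : Finset.Iic 0) → E =>
      y ⟨0, Finset.mem_Iic.2 le_rfl⟩) (measurable_pi_apply _) (Preorder.measurable_frestrictLe 0),
    jumpChainLaw, Kernel.trajMeasure, Measure.map_comp _ _ (by fun_prop),
    Kernel.traj_map_frestrictLe, Kernel.partialTraj_self, Measure.id_comp, Measure.map_map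
    (measurable_pi_apply _) (by fun_prop)]
  convert Measure.map_id
  ext a
  rfl

lemma ae_jumpChainLaw_zero (r : JumpRates E) (x : E) : ∀ᵐ ω ∂r.jumpChainLaw x, ω 0 = x := by
  have h : ∀ᵐ y ∂(r.jumpChainLaw x).map (fun ω => ω 0), y = x := by
    rw [jumpChainLaw_map_eval_zero, ae_dirac_iff (.of_discrete)]
  exact ae_of_ae_map (measurable_pi_apply 0).aemeasurable h

lemma jumpChainLaw_pathCylinder_succ (r : JumpRates E) (x : E) (e : ℕ → E) (n : ℕ) :
    r.jumpChainLaw x (pathCylinder e (n + 1)) =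
      r.jumpChainLaw x (pathCylinder e n) * r.jumpPMF (e n) (e (n + 1)) := by
  have key := Kernel.map_frestrictLe_trajMeasure_compProd_eq_map_trajMeasure (X := fun _ => E)
    (μ₀ := Measure.dirac x) (κ := fun n =>
    r.jumpKernel.comap (fun y : (i : Finset.Iic n) → E => y ⟨n, Finset.mem_Iic.2 le_rfl⟩)
      (measurable_pi_apply _)) (a := n)
  have key2 := congrArg (fun m => m ({Preorder.frestrictLe (π := fun _ => E) n e} ×ˢ {e (n + 1)})) key
  have hs : pathCylinder e (n + 1) =
      (fun ω : ℕ → E => (Preorder.frestrictLe (π := fun _ => E) n ω, ω (n + 1))) ⁻¹'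
        ({Preorder.frestrictLe (π := fun _ => E) n e} ×ˢ {e (n + 1)}) := by
    ext ω
    simp [pathCylinder, funext_iff, Nat.le_succ_iff, or_imp, forall_and]
  rw [Measure.map_apply (by fun_prop)
    ((measurableSet_singleton _).prod (measurableSet_singleton _)), ← hs,
    Measure.compProd_apply_prod (measurableSet_singleton _) (measurableSet_singleton _),
    lintegral_singleton, Measure.map_apply (Preorder.measurable_frestrictLe n)
      (measurableSet_singleton _), ← pathCylinder_eq_preimage] at key2
  rw [jumpChainLaw, ← key2, mul_comm]
  congr 1
  exact PMF.toMeasure_apply_singleton _ _ (measurableSet_singleton _)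

lemma jumpChainLaw_pathCylinder_of_ne (r : JumpRates E) {x : E} {e : ℕ → E} (h : e 0 ≠ x) (n : ℕ) :
    r.jumpChainLaw x (pathCylinder e n) = 0 := by
  refine measure_eq_zero_iff_ae_notMem.2 ?_
  filter_upwards [r.ae_jumpChainLaw_zero x] with ω h' hω
  exact h ((hω 0 (Nat.zero_le n)).symm.trans h')

lemma jumpChainLaw_pathCylinder_zero (r : JumpRates E) {x : E} {e : ℕ → E} (h : e 0 = x) :
    r.jumpChainLaw x (pathCylinder e 0) = 1 := by
  refine (mem_ae_iff_prob_eq_one (measurableSet_pathCylinder e 0)).1 ?_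
  filter_upwards [r.ae_jumpChainLaw_zero x] with ω h' i hi
  obtain rfl : i = 0 := by omega
  exact h'.trans h.symm

lemma jumpChainLaw_pathCylinder_cons (r : JumpRates E) (x : E) (e : ℕ → E) (n : ℕ) :
    r.jumpChainLaw x (pathCylinder (pathCons x e) (n + 1)) =
      r.jumpPMF x (e 0) * r.jumpChainLaw (e 0) (pathCylinder e n) := by
  induction n with
  | zero =>
    rw [jumpChainLaw_pathCylinder_succ,
      jumpChainLaw_pathCylinder_zero (x := x) (e := pathCons x e) _ rfl,
      jumpChainLaw_pathCylinder_zero (e := e) _ rfl, mul_comm]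
    rfl
  | succ n ih =>
    rw [jumpChainLaw_pathCylinder_succ, ih, jumpChainLaw_pathCylinder_succ, mul_assoc]
    rfl

/-- The Markov property of the jump chain at the first jump. -/
lemma jumpChainLaw_map_pathShift (r : JumpRates E) (x : E) :
    (r.jumpChainLaw x).map pathShift =
      Measure.sum fun y => r.jumpPMF x y • r.jumpChainLaw y := by
  have : IsFiniteMeasure (Measure.sum fun y => r.jumpPMF x y • r.jumpChainLaw y) := by
    refine ⟨?_⟩
    rw [Measure.sum_apply _ .univ]
    simp [PMF.tsum_coe]
  refine measure_ext_pathCylinder fun e n => ?_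
  rw [Measure.map_apply measurable_pathShift (measurableSet_pathCylinder e n),
    Measure.sum_apply _ (measurableSet_pathCylinder e n), tsum_eq_single (e 0)]
  · rw [Measure.smul_apply, smul_eq_mul, ← jumpChainLaw_pathCylinder_cons]
    refine measure_congr ?_
    filter_upwards [r.ae_jumpChainLaw_zero x] with ω hω
    refine propext ⟨fun h i hi => ?_, fun h i hi => h (i + 1) (by omega)⟩
    cases i with
    | zero => exact hω
    | succ i => exact h i (by omega)
  · intro y hy
    rw [Measure.smul_apply, jumpChainLaw_pathCylinder_of_ne _ hy.symm, smul_zero]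

lemma jumpChainLaw_preimage_pathShift (r : JumpRates E) (x : E) {S : Set (ℕ → E)}
    (hS : MeasurableSet S) :
    r.jumpChainLaw x (pathShift ⁻¹' S) = ∑' y, r.jumpPMF x y * r.jumpChainLaw y S := by
  rw [← Measure.map_apply measurable_pathShift hS, jumpChainLaw_map_pathShift,
    Measure.sum_apply _ hS]
  rfl

end Chain

end JumpRates

namespace JumpRates

/-! ### Rates, jump probabilities and the generator -/

section Rates

variable {E : Type*} (r : JumpRates E)

/-- The jump probabilities are the jump rates divided by the holding rate. -/
lemma holdingRate_mul_jumpPMF (x y : E) :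
    (r.holdingRate x : ℝ≥0∞) * r.jumpPMF x y = r.rate x y := by
  have hsum : (r.holdingRate x : ℝ≥0∞) = ∑' y, (r.rate x y : ℝ≥0∞) :=
    ENNReal.coe_tsum (r.summable_rate x)
  rw [hsum, jumpPMF]
  split_ifs with h
  -- At an absorbing state both sides vanish, whatever value `jumpPMF` takes there.
  · rw [h, zero_mul, ENNReal.tsum_eq_zero.1 h y]
  · rw [PMF.normalize_apply, mul_comm, mul_assoc, ENNReal.inv_mul_cancel h
      (ENNReal.tsum_coe_ne_top_iff_summable.2 (r.summable_rate x)), mul_one]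

lemma summable_rate_mul_of_bounded (x : E) {f : E → ℝ} {C : ℝ} (hf : ∀ y, |f y| ≤ C) :
    Summable fun y => (r.rate x y : ℝ) * f y := by
  refine .of_norm_bounded ((NNReal.summable_coe.2 (r.summable_rate x)).mul_right C) fun y => ?_
  rw [norm_mul, Real.norm_eq_abs, Real.norm_eq_abs, NNReal.abs_eq]
  exact mul_le_mul_of_nonneg_left (hf y) NNReal.zero_le_coe

lemma tsum_coe_rate (x : E) : ∑' y, (r.rate x y : ℝ) = r.holdingRate x :=
  (NNReal.coe_tsum).symm

lemma generator_eq_sub (x : E) {f : E → ℝ} (hf : Summable fun y => (r.rate x y : ℝ) * f y) :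
    r.generator f x = ∑' y, (r.rate x y : ℝ) * f y - r.holdingRate x * f x := by
  rw [generator, ← tsum_coe_rate, ← tsum_mul_right,
    ← hf.tsum_sub ((NNReal.summable_coe.2 (r.summable_rate x)).mul_right _)]
  exact tsum_congr fun y => mul_sub _ _ _

end Rates

/-! ### From continuous time to the jump chain -/

section Times

variable {E : Type*} (r : JumpRates E) {ω : Sample E}

/-- The paths that visit `A` before `B`, for disjoint `A` and `B`. -/
def hitBefore (A B : Set E) : Set (ℕ → E) :=
  {y | ∃ n, y n ∈ A ∧ ∀ k < n, y k ∉ A ∧ y k ∉ B}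

lemma jumpTime_zero : r.jumpTime ω 0 = 0 := by simp [jumpTime]

lemma jumpTime_succ (n : ℕ) : r.jumpTime ω (n + 1) = r.jumpTime ω n + r.holdingTime ω n :=
  Finset.sum_range_succ _ _

lemma jumpTime_monotone : Monotone (r.jumpTime ω) :=
  monotone_nat_of_le_succ fun n => by rw [jumpTime_succ]; exact le_self_add

lemma jumpTime_lt_succ (hω : ∀ n, 0 < ω.2 n) {n : ℕ} (hn : r.jumpTime ω n ≠ ∞) :
    r.jumpTime ω n < r.jumpTime ω (n + 1) := by
  rw [jumpTime_succ]
  refine ENNReal.lt_add_right hn (ENNReal.div_pos ?_ ENNReal.coe_ne_top).ne'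
  exact (ENNReal.ofReal_pos.2 (hω n)).ne'

lemma jumpTime_ne_top (h : ∀ x, 0 < r.holdingRate x) (n : ℕ) : r.jumpTime ω n ≠ ∞ := by
  refine ENNReal.sum_ne_top.2 fun k _ => ENNReal.div_ne_top ENNReal.ofReal_ne_top ?_
  exact ENNReal.coe_ne_zero.2 (h _).ne'

lemma position_eq_some {n : ℕ} {t : ℝ≥0} (h₁ : r.jumpTime ω n ≤ t)
    (h₂ : t < r.jumpTime ω (n + 1)) : r.position ω t = some (ω.1 n) := by
  classical
  have h : ∃ n, r.jumpTime ω n ≤ t ∧ t < r.jumpTime ω (n + 1) := ⟨n, h₁, h₂⟩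
  rw [position, dif_pos h]
  refine congrArg (fun k => some (ω.1 k)) ((Nat.find_eq_iff h).2 ⟨⟨h₁, h₂⟩, fun m hm hm' => ?_⟩)
  exact absurd hm'.2 (not_lt.2 ((r.jumpTime_monotone hm).trans h₁))

lemma exists_of_position_eq_some {t : ℝ≥0} {a : E} (h : r.position ω t = some a) :
    ∃ n, r.jumpTime ω n ≤ t ∧ t < r.jumpTime ω (n + 1) ∧ ω.1 n = a := by
  classical
  rw [position] at h
  split_ifs at h with h'
  exact ⟨_, (Nat.find_spec h').1, (Nat.find_spec h').2, Option.some_injective _ h⟩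

/-- Each visit starts at a jump time and lasts for a positive time, and after an explosion the
process is in no state of `E`. -/
lemma hittingTime_eq_iInf (hω : ∀ n, 0 < ω.2 n) (A : Set E) :
    r.hittingTime A ω = ⨅ (n : ℕ) (_ : ω.1 n ∈ A), r.jumpTime ω n := by
  refine le_antisymm (le_iInf₂ fun n hn => le_of_forall_gt_imp_ge_of_dense fun c hc => ?_)
    (le_iInf₂ fun t ht => ?_)
  · have hc' : r.jumpTime ω n < min c (r.jumpTime ω (n + 1)) :=
      lt_min hc (r.jumpTime_lt_succ hω hc.ne_top)
    obtain ⟨t, ht₁, ht₂⟩ := ENNReal.lt_iff_exists_nnreal_btwn.1 hc'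
    refine (iInf₂_le t ⟨?_, ω.1 n, hn, ?_⟩).trans (ht₂.le.trans (min_le_left _ _))
    · exact ENNReal.coe_pos.1 (zero_le.trans_lt ht₁)
    · exact r.position_eq_some ht₁.le (ht₂.trans_le (min_le_right _ _))
  · obtain ⟨-, a, ha, hpos⟩ := ht
    obtain ⟨n, h₁, -, rfl⟩ := r.exists_of_position_eq_some hpos
    exact (iInf₂_le n ha).trans h₁

lemma returnTime_eq_iInf (hω : ∀ n, 0 < ω.2 n) (h01 : ω.1 1 ≠ ω.1 0) (A : Set E) :
    r.returnTime A ω = ⨅ (n : ℕ) (_ : ω.1 (n + 1) ∈ A), r.jumpTime ω (n + 1) := by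
  have hstart : ∀ s : ℝ≥0, s < r.jumpTime ω 1 → r.position ω s = some (ω.1 0) := fun s hs =>
    r.position_eq_some (by rw [jumpTime_zero]; exact zero_le) hs
  refine le_antisymm (le_iInf₂ fun n hn => le_of_forall_gt_imp_ge_of_dense fun c hc => ?_)
    (le_iInf₂ fun t ht => ?_)
  · have hc' : r.jumpTime ω (n + 1) < min c (r.jumpTime ω (n + 2)) :=
      lt_min hc (r.jumpTime_lt_succ hω hc.ne_top)
    obtain ⟨t, ht₁, ht₂⟩ := ENNReal.lt_iff_exists_nnreal_btwn.1 hc'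
    have h1 : r.jumpTime ω 1 ≤ r.jumpTime ω (n + 1) := r.jumpTime_monotone (by omega)
    -- A time `s < t` during the stay in the second state witnesses that the process has left `X_0`.
    have hs : r.jumpTime ω 1 < min (t : ℝ≥0∞) (r.jumpTime ω 2) :=
      lt_min (h1.trans_lt ht₁) (r.jumpTime_lt_succ hω (h1.trans_lt hc).ne_top)
    obtain ⟨s, hs₁, hs₂⟩ := ENNReal.lt_iff_exists_nnreal_btwn.1 hs
    refine (iInf₂_le t ⟨?_, ⟨ω.1 (n + 1), hn, ?_⟩, s, ?_, ?_, ?_⟩).trans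
      (ht₂.le.trans (min_le_left _ _))
    · exact ENNReal.coe_pos.1 (zero_le.trans_lt ht₁)
    · exact r.position_eq_some ht₁.le (ht₂.trans_le (min_le_right _ _))
    · exact ENNReal.coe_pos.1 (zero_le.trans_lt hs₁)
    · exact ENNReal.coe_lt_coe.1 (hs₂.trans_le (min_le_left _ _))
    · rw [r.position_eq_some hs₁.le (hs₂.trans_le (min_le_right _ _)), hstart 0]
      · simpa using h01
      · have h0 := r.jumpTime_lt_succ hω (n := 0) (by simp [jumpTime_zero])
        rwa [jumpTime_zero] at h0
  · obtain ⟨-, ⟨a, ha, hpos⟩, s, -, hst, hs⟩ := ht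
    obtain ⟨n, h₁, h₂, rfl⟩ := r.exists_of_position_eq_some hpos
    cases n with
    | zero =>
      have hs' : (s : ℝ≥0∞) < r.jumpTime ω 1 := (ENNReal.coe_lt_coe.2 hst).trans h₂
      exact absurd ((hstart s hs').trans (hstart 0 (zero_le.trans_lt hs')).symm) hs
    | succ n => exact (iInf₂_le n ha).trans h₁

/-- Comparison of the first indices along a sequence of times that increases strictly as long as
it is finite. -/
lemma iInf_lt_iInf_iff_exists {J : ℕ → ℝ≥0∞} (hmono : Monotone J)
    (hlt : ∀ n, J n ≠ ∞ → J n < J (n + 1)) {P Q : ℕ → Prop} (hPQ : ∀ n, P n → ¬ Q n)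
    (hfin : ∀ n, P n → (∀ k < n, ¬ P k ∧ ¬ Q k) → J n ≠ ∞) :
    (⨅ (n : ℕ) (_ : P n), J n) < (⨅ (n : ℕ) (_ : Q n), J n) ↔
      ∃ n, P n ∧ ∀ k < n, ¬ P k ∧ ¬ Q k := by
  classical
  constructor
  · intro h
    obtain ⟨n, hn⟩ := iInf_lt_iff.1 h
    obtain ⟨hPn, hn⟩ := iInf_lt_iff.1 hn
    have hex : ∃ n, P n ∨ Q n := ⟨n, .inl hPn⟩
    refine ⟨Nat.find hex, (Nat.find_spec hex).resolve_right fun hQ => ?_,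
      fun k hk => not_or.1 (Nat.find_min hex hk)⟩
    exact absurd hn (not_lt.2 ((iInf₂_le _ hQ).trans (hmono (Nat.find_min' hex (.inl hPn)))))
  · rintro ⟨n, hPn, hn⟩
    -- Any index with `Q` is at least `n + 1`; the strict step from `J n` to `J (n + 1)` keeps the
    -- inequality strict in the infimum.
    refine (iInf₂_le n hPn).trans_lt ((hlt n (hfin n hPn hn)).trans_le (le_iInf₂ fun m hm => ?_))
    refine hmono (Nat.succ_le_of_lt ?_)
    by_contra hmn
    rcases (not_lt.1 hmn).eq_or_lt with rfl | h
    · exact hPQ _ hPn hm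
    · exact (hn m h).2 hm

lemma hittingTime_lt_iff (hr : Nontrivial E → ∀ x, 0 < r.holdingRate x) (hω : ∀ n, 0 < ω.2 n)
    {A B : Set E} (hAB : Disjoint A B) :
    r.hittingTime A ω < r.hittingTime B ω ↔ ω.1 ∈ hitBefore A B := by
  rw [r.hittingTime_eq_iInf hω, r.hittingTime_eq_iInf hω]
  refine iInf_lt_iInf_iff_exists r.jumpTime_monotone (fun n => r.jumpTime_lt_succ hω)
    (fun n h => Set.disjoint_left.1 hAB h) fun n hn hk => ?_
  cases n with
  | zero => simp [jumpTime_zero]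
  | succ n =>
    -- The path has seen two distinct states, so `E` is nontrivial and no state is absorbing.
    refine r.jumpTime_ne_top (hr ⟨ω.1 (n + 1), ω.1 0, fun h => ?_⟩) _
    exact (hk 0 (Nat.succ_pos n)).1 (h ▸ hn)

lemma returnTime_lt_iff (hr : Nontrivial E → ∀ x, 0 < r.holdingRate x) (hω : ∀ n, 0 < ω.2 n)
    (h01 : ω.1 1 ≠ ω.1 0) {A B : Set E} (hAB : Disjoint A B) :
    r.returnTime A ω < r.returnTime B ω ↔ pathShift ω.1 ∈ hitBefore A B := by
  rw [r.returnTime_eq_iInf hω h01, r.returnTime_eq_iInf hω h01]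
  exact iInf_lt_iInf_iff_exists (J := fun n => r.jumpTime ω (n + 1))
    (fun m n h => r.jumpTime_monotone (Nat.succ_le_succ h)) (fun n => r.jumpTime_lt_succ hω)
    (fun n h => Set.disjoint_left.1 hAB h)
    fun n _ _ => r.jumpTime_ne_top (hr ⟨_, _, h01⟩) _

end Times

/-! ### Hitting probabilities and first-step analysis -/

section Laws

lemma measurableSet_hitBefore {E : Type*} [MeasurableSpace E] [DiscreteMeasurableSpace E]
    (A B : Set E) : MeasurableSet (hitBefore A B) := by
  have h : hitBefore A B = ⋃ n, (fun y : ℕ → E => y n) ⁻¹' A ∩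
      ⋂ k, ⋂ (_ : k < n), ((fun y : ℕ → E => y k) ⁻¹' Aᶜ ∩ (fun y : ℕ → E => y k) ⁻¹' Bᶜ) := by
    ext y; simp [hitBefore]
  rw [h]
  exact .iUnion fun n => (measurable_pi_apply n .of_discrete).inter <| .iInter fun k =>
    .iInter fun _ => (measurable_pi_apply k .of_discrete).inter (measurable_pi_apply k .of_discrete)

variable {E : Type*} [Countable E] [MeasurableSpace E] [DiscreteMeasurableSpace E]
  (r : JumpRates E)

lemma isProbabilityMeasure_clocks :
    IsProbabilityMeasure (Measure.infinitePi fun _ : ℕ => expMeasure 1) := by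
  have := isProbabilityMeasure_expMeasure one_pos
  infer_instance

lemma measurePreserving_fst_law (x : E) :
    MeasurePreserving Prod.fst (r.law x) (r.jumpChainLaw x) := by
  have := isProbabilityMeasure_clocks
  exact measurePreserving_fst

lemma ae_expMeasure_pos : ∀ᵐ t ∂expMeasure 1, 0 < t := by
  have := isProbabilityMeasure_expMeasure one_pos
  have h : expMeasure 1 (Set.Iic 0) = 0 := by
    have h := cdf_expMeasure_eq one_pos 0
    rw [cdf_eq_real] at h
    simpa [measureReal_eq_zero_iff] using h
  refine (measure_eq_zero_iff_ae_notMem.1 h).mono fun t ht => not_le.1 ht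

lemma ae_law_clocks_pos (x : E) : ∀ᵐ ω ∂r.law x, ∀ n, 0 < ω.2 n := by
  have := isProbabilityMeasure_expMeasure one_pos
  have := isProbabilityMeasure_clocks
  have h : ∀ᵐ c ∂(Measure.infinitePi fun _ : ℕ => expMeasure 1), ∀ n, 0 < c n :=
    ae_all_iff.2 fun n => (measurePreserving_eval_infinitePi (fun _ : ℕ => expMeasure 1)
      n).quasiMeasurePreserving.ae ae_expMeasure_pos
  exact (measurePreserving_snd (μ := r.jumpChainLaw x)).quasiMeasurePreserving.ae h

lemma law_hittingTime_lt (hr : Nontrivial E → ∀ x, 0 < r.holdingRate x) {A B : Set E}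
    (hAB : Disjoint A B) (x : E) :
    r.law x {ω | r.hittingTime A ω < r.hittingTime B ω} = r.jumpChainLaw x (hitBefore A B) := by
  rw [← (r.measurePreserving_fst_law x).measure_preimage
    (measurableSet_hitBefore A B).nullMeasurableSet]
  refine measure_congr ?_
  filter_upwards [r.ae_law_clocks_pos x] with ω hω
  exact propext (r.hittingTime_lt_iff hr hω hAB)

lemma ae_jumpChainLaw_one_ne_zero {x : E} (hx : r.holdingRate x ≠ 0) :
    ∀ᵐ ω ∂r.jumpChainLaw x, ω 1 ≠ ω 0 := by
  have hS : MeasurableSet {ω : ℕ → E | ω 0 = x} := 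
    measurableSet_eq_fun (measurable_pi_apply 0) measurable_const
  have h : r.jumpChainLaw x (pathShift ⁻¹' {ω | ω 0 = x}) = 0 := by
    rw [jumpChainLaw_preimage_pathShift _ _ hS, ENNReal.tsum_eq_zero]
    intro y
    by_cases hy : y = x
    · have hxx := r.holdingRate_mul_jumpPMF x x
      rw [r.rate_self, ENNReal.coe_zero, mul_eq_zero] at hxx
      rw [hy, hxx.resolve_left (ENNReal.coe_ne_zero.2 hx), zero_mul]
    · rw [measure_eq_zero_iff_ae_notMem.2, mul_zero]
      filter_upwards [r.ae_jumpChainLaw_zero y] with ω hω hω'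
      exact hy (hω.symm.trans hω')
  filter_upwards [measure_eq_zero_iff_ae_notMem.1 h, r.ae_jumpChainLaw_zero x] with ω h₁ h₂ h₃
  exact h₁ (h₃.trans h₂)

lemma law_returnTime_lt (hr : Nontrivial E → ∀ x, 0 < r.holdingRate x) {A B : Set E}
    (hAB : Disjoint A B) {x : E} (hx : r.holdingRate x ≠ 0) :
    r.law x {ω | r.returnTime A ω < r.returnTime B ω} =
      r.jumpChainLaw x (pathShift ⁻¹' hitBefore A B) := by
  rw [← (r.measurePreserving_fst_law x).measure_preimage
    (measurable_pathShift (measurableSet_hitBefore A B)).nullMeasurableSet]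
  refine measure_congr ?_
  filter_upwards [r.ae_law_clocks_pos x, (r.measurePreserving_fst_law
    x).quasiMeasurePreserving.ae (r.ae_jumpChainLaw_one_ne_zero hx)] with ω hω h01
  exact propext (r.returnTime_lt_iff hr hω h01 hAB)

/-- The probability, for the chain started at `x`, of hitting `A` before `B`. -/
noncomputable def hitProb (A B : Set E) (x : E) : ℝ := (r.jumpChainLaw x).real (hitBefore A B)

lemma hitProb_of_mem_left {A : Set E} (B : Set E) {x : E} (hx : x ∈ A) : r.hitProb A B x = 1 := by
  rw [hitProb, measureReal_def,
    (mem_ae_iff_prob_eq_one (measurableSet_hitBefore A B)).1, ENNReal.toReal_one]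
  filter_upwards [r.ae_jumpChainLaw_zero x] with ω hω
  exact ⟨0, hω ▸ hx, by simp⟩

lemma hitProb_of_mem_right {A B : Set E} (hAB : Disjoint A B) {x : E} (hx : x ∈ B) :
    r.hitProb A B x = 0 := by
  rw [hitProb, measureReal_def, measure_eq_zero_iff_ae_notMem.2, ENNReal.toReal_zero]
  filter_upwards [r.ae_jumpChainLaw_zero x] with ω hω
  rintro ⟨n, hn, hk⟩
  cases n with
  | zero => exact Set.disjoint_left.1 hAB hn (hω ▸ hx)
  | succ n => exact (hk 0 n.succ_pos).2 (hω ▸ hx)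

lemma hitProb_nonneg (A B : Set E) (x : E) : 0 ≤ r.hitProb A B x := measureReal_nonneg

lemma hitProb_le_one (A B : Set E) (x : E) : r.hitProb A B x ≤ 1 := measureReal_le_one

lemma holdingRate_mul_preimage_pathShift (A B : Set E) (x : E) :
    (r.holdingRate x : ℝ≥0∞) * r.jumpChainLaw x (pathShift ⁻¹' hitBefore A B) =
      ∑' y, ENNReal.ofReal (r.rate x y * r.hitProb A B y) := by
  rw [jumpChainLaw_preimage_pathShift _ _ (measurableSet_hitBefore A B), ← ENNReal.tsum_mul_left]
  refine tsum_congr fun y => ?_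
  rw [← mul_assoc, holdingRate_mul_jumpPMF, ENNReal.ofReal_mul NNReal.zero_le_coe, hitProb,
    ofReal_measureReal, ENNReal.ofReal_coe_nnreal]

lemma summable_rate_mul_hitProb (A B : Set E) (x : E) :
    Summable fun y => (r.rate x y : ℝ) * r.hitProb A B y :=
  r.summable_rate_mul_of_bounded x (C := 1) fun y => by
    rw [abs_of_nonneg (r.hitProb_nonneg A B y)]; exact r.hitProb_le_one A B y

/-- The hitting probabilities are harmonic outside `A ∪ B`. -/
lemma generator_hitProb (A B : Set E) {x : E} (hxA : x ∉ A) (hxB : x ∉ B) :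
    r.generator (r.hitProb A B) x = 0 := by
  -- From a state outside `A ∪ B`, dropping the initial state does not change which set is hit
  -- first.
  have h : r.jumpChainLaw x (pathShift ⁻¹' hitBefore A B) = r.jumpChainLaw x (hitBefore A B) := by
    refine measure_congr ?_
    filter_upwards [r.ae_jumpChainLaw_zero x] with ω hω
    refine propext ⟨?_, ?_⟩
    · rintro ⟨n, hn, hk⟩
      refine ⟨n + 1, hn, fun k hkn => ?_⟩
      cases k with
      | zero => rw [hω]; exact ⟨hxA, hxB⟩
      | succ k => exact hk k (by omega)
    · rintro ⟨n, hn, hk⟩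
      cases n with
      | zero => rw [hω] at hn; exact absurd hn hxA
      | succ n => exact ⟨n, hn, fun k hkn => hk (k + 1) (by omega)⟩
  have key := congrArg ENNReal.toReal (r.holdingRate_mul_preimage_pathShift A B x)
  rw [h, ENNReal.toReal_mul, ENNReal.coe_toReal, ← ENNReal.ofReal_tsum_of_nonneg
    (fun y => mul_nonneg NNReal.zero_le_coe (r.hitProb_nonneg A B y))
    (r.summable_rate_mul_hitProb A B x), ENNReal.toReal_ofReal (tsum_nonneg
    fun y => mul_nonneg NNReal.zero_le_coe (r.hitProb_nonneg A B y))] at key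
  rw [r.generator_eq_sub x (r.summable_rate_mul_hitProb A B x), ← key]
  exact sub_self _

end Laws

end JumpRates

/-! ### Functions constant on `B` -/

/-- The function `f` is constant on `B`. -/
def ConstOn {E : Type*} (B : Set E) (f : E → ℝ) : Prop := ∃ c, ∀ x ∈ B, f x = c

section ConstOn

variable {E : Type*} {B : Set E} {f g : E → ℝ}

lemma constOn_const (B : Set E) (c : ℝ) : ConstOn B (fun _ => c) := ⟨c, fun _ _ => rfl⟩

lemma ConstOn.linearComb (hf : ConstOn B f) (hg : ConstOn B g) (a b : ℝ) :
    ConstOn B (fun x => a * f x + b * g x) := by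
  obtain ⟨c, hc⟩ := hf
  obtain ⟨d, hd⟩ := hg
  exact ⟨a * c + b * d, fun x hx => by simp only [hc x hx, hd x hx]⟩

lemma ConstOn.exists_abs_le (hB : Bᶜ.Finite) (hf : ConstOn B f) : ∃ C, ∀ x, |f x| ≤ C := by
  obtain ⟨c, hc⟩ := hf
  have hfin : (Set.range fun x => |f x|).Finite := by
    refine ((hB.image fun x => |f x|).union (Set.finite_singleton |c|)).subset ?_
    rintro _ ⟨x, rfl⟩
    by_cases hx : x ∈ B
    · exact .inr (by simp [hc x hx])
    · exact .inl ⟨x, hx, rfl⟩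
  obtain ⟨C, hC⟩ := hfin.bddAbove
  exact ⟨C, fun x => hC ⟨x, rfl⟩⟩

end ConstOn

namespace JumpRates

/-! ### Maximum principle and the Dirichlet problem -/

section Harmonic

variable {E : Type*} (r : JumpRates E) {B : Set E} {f g : E → ℝ}

lemma summable_rate_mul (hB : Bᶜ.Finite) (hf : ConstOn B f) (x : E) :
    Summable fun y => (r.rate x y : ℝ) * f y := by
  obtain ⟨C, hC⟩ := hf.exists_abs_le hB
  exact r.summable_rate_mul_of_bounded x hC

lemma generator_const (c : ℝ) (x : E) : r.generator (fun _ => c) x = 0 := by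
  simp [generator]

lemma generator_linearComb (hB : Bᶜ.Finite) (hf : ConstOn B f) (hg : ConstOn B g) (a b : ℝ)
    (x : E) : r.generator (fun x => a * f x + b * g x) x =
      a * r.generator f x + b * r.generator g x := by
  have h₁ := r.summable_rate_mul hB hf x
  have h₂ := r.summable_rate_mul hB hg x
  rw [r.generator_eq_sub x h₁, r.generator_eq_sub x h₂,
    r.generator_eq_sub x (r.summable_rate_mul hB (hf.linearComb hg a b) x)]
  have h : ∑' y, (r.rate x y : ℝ) * (a * f y + b * g y) =
      a * ∑' y, (r.rate x y : ℝ) * f y + b * ∑' y, (r.rate x y : ℝ) * g y := by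
    rw [← tsum_mul_left, ← tsum_mul_left, ← (h₁.mul_left a).tsum_add (h₂.mul_left b)]
    exact tsum_congr fun y => by ring
  rw [h]
  ring

/-- The maximum principle: a function that vanishes on `D` and is harmonic outside `D` is
nonpositive. -/
lemma nonpos_of_generator_eq_zero (hr : r.Irreducible) {D : Set E} (hD : D.Nonempty)
    (hfin : Dᶜ.Finite) (h₀ : ∀ x ∈ D, f x = 0) (h : ∀ x ∉ D, r.generator f x = 0) (z : E) :
    f z ≤ 0 := by
  by_contra! hz
  have hzD : z ∈ Dᶜ := fun hzD => hz.ne' (h₀ z hzD)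
  obtain ⟨x, -, hx⟩ := Set.exists_max_image Dᶜ f hfin ⟨z, hzD⟩
  have hpos : 0 < f x := hz.trans_le (hx z hzD)
  have hmax : ∀ y, f y ≤ f x := fun y => by
    by_cases hy : y ∈ D
    · exact (h₀ y hy).trans_le hpos.le
    · exact hx y hy
  -- The maximum spreads along jumps: at a maximum `b` outside `D`, the terms `r(b, y) (f b - f y)`
  -- are nonnegative with sum zero. Irreducibility carries it into `D`, where `f = 0`.
  have hreach : ∀ y, Relation.ReflTransGen (fun u v => 0 < r.rate u v) x y → f y = f x := by
    intro y hy
    induction hy with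
    | refl => rfl
    | @tail b c _ hbc ih =>
      have hb : b ∉ D := fun hb => hpos.ne' (ih.symm.trans (h₀ b hb))
      have hsum : Summable fun y => (r.rate b y : ℝ) * (f b - f y) :=
        r.summable_rate_mul hfin ⟨f b, fun y hy => by rw [h₀ y hy, sub_zero]⟩ b
      have hzero : ∑' y, (r.rate b y : ℝ) * (f b - f y) = 0 := by
        rw [← neg_eq_zero, ← tsum_neg, ← h b hb]
        exact tsum_congr fun y => by ring
      have hterm := (hsum.hasSum_iff.2 hzero)
      rw [hasSum_zero_iff_of_nonneg fun y => mul_nonneg NNReal.zero_le_coe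
        (sub_nonneg.2 (ih ▸ hmax y))] at hterm
      have hc := congrFun hterm c
      simp only [Pi.zero_apply, mul_eq_zero, NNReal.coe_eq_zero, hbc.ne', false_or] at hc
      linarith
  obtain ⟨d, hd⟩ := hD
  exact hpos.ne' ((hreach d (hr x d)).symm.trans (h₀ d hd))

/-- Uniqueness in the Dirichlet problem. -/
lemma eq_zero_of_generator_eq_zero (hr : r.Irreducible) {D : Set E} (hD : D.Nonempty)
    (hfin : Dᶜ.Finite) (h₀ : ∀ x ∈ D, f x = 0) (h : ∀ x ∉ D, r.generator f x = 0) (z : E) :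
    f z = 0 := by
  refine le_antisymm (r.nonpos_of_generator_eq_zero hr hD hfin h₀ h z) ?_
  have hf : ConstOn D f := ⟨0, h₀⟩
  have key := r.nonpos_of_generator_eq_zero (f := fun x => (-1) * f x + 0 * f x) hr hD hfin
    (fun x hx => by rw [h₀ x hx]; ring)
    (fun x hx => by rw [r.generator_linearComb hfin hf hf, h x hx]; ring) z
  linarith

lemma Irreducible.holdingRate_pos {r : JumpRates E} (hr : r.Irreducible) [Nontrivial E] (x : E) :
    0 < r.holdingRate x := by
  obtain ⟨y, hy⟩ := exists_ne x
  rcases Relation.ReflTransGen.cases_head (hr x y) with h | ⟨z, hz, -⟩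
  · exact absurd h.symm hy
  · exact NNReal.tsum_pos (r.summable_rate x) z hz

end Harmonic

/-! ### Equilibrium potential and capacity -/

section Potential

variable {E : Type*} [Countable E] [MeasurableSpace E] [DiscreteMeasurableSpace E]
  (r : JumpRates E) {A B : Set E}

lemma equilibriumPotential_eq_hitProb (hr : r.Irreducible) (hAB : Disjoint A B) (x : E) :
    r.equilibriumPotential A B x = r.hitProb A B x := by
  rw [equilibriumPotential, hitProb, measureReal_def, measureReal_def,
    r.law_hittingTime_lt (fun _ => hr.holdingRate_pos) hAB]

lemma constOn_hitProb (hAB : Disjoint A B) : ConstOn B (r.hitProb A B) :=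
  ⟨0, fun _ hx => r.hitProb_of_mem_right hAB hx⟩

/-- The difference of the two sides solves the Dirichlet problem with zero data. Thus `A ∪ B` is hit
almost surely, with no recurrence assumption. -/
lemma hitProb_add_hitProb_swap (hr : r.Irreducible) (hAB : Disjoint A B) (hB : Bᶜ.Finite)
    (hne : (A ∪ B).Nonempty) (x : E) : r.hitProb A B x + r.hitProb B A x = 1 := by
  have hV := r.constOn_hitProb hAB
  have hV' : ConstOn B (r.hitProb B A) := ⟨1, fun _ hx => r.hitProb_of_mem_left A hx⟩
  have h1 : ConstOn B (fun _ : E => (1 : ℝ)) := constOn_const B 1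
  have key := r.eq_zero_of_generator_eq_zero
    (f := fun x => 1 * (1 * r.hitProb A B x + 1 * r.hitProb B A x) + (-1) * 1) hr hne
    (hB.subset (Set.compl_subset_compl.2 Set.subset_union_right)) ?_ ?_ x
  · linarith
  · rintro y (hy | hy)
    · rw [r.hitProb_of_mem_left B hy, r.hitProb_of_mem_right hAB.symm hy]; ring
    · rw [r.hitProb_of_mem_left A hy, r.hitProb_of_mem_right hAB hy]; ring
  · intro y hy
    rw [Set.mem_union, not_or] at hy
    rw [r.generator_linearComb hB (hV.linearComb hV' 1 1) h1, r.generator_linearComb hB hV hV',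
      r.generator_hitProb A B hy.1 hy.2, r.generator_hitProb B A hy.2 hy.1, r.generator_const]
    ring

/-- After the first jump, the return event is that of hitting `B` before `A`, of probability `1 -
V(y)` from `y`; and `V(x) = 1`. -/
lemma holdingRate_mul_law_returnTime (hr : r.Irreducible) (hAB : Disjoint A B) (hB : Bᶜ.Finite)
    {x : E} (hx : x ∈ A) :
    (r.holdingRate x : ℝ≥0∞) * r.law x {ω | r.returnTime A ω > r.returnTime B ω} =
      ENNReal.ofReal (-r.generator (r.hitProb A B) x) := by
  have hswap : ∀ y, r.hitProb B A y = 1 - r.hitProb A B y := fun y => by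
    rw [← r.hitProb_add_hitProb_swap hr hAB hB ⟨x, .inl hx⟩ y]; ring
  have hgen : -r.generator (r.hitProb A B) x = ∑' y, (r.rate x y : ℝ) * r.hitProb B A y := by
    rw [generator, ← tsum_neg]
    refine tsum_congr fun y => ?_
    rw [hswap, r.hitProb_of_mem_left B hx]
    ring
  rw [hgen, ENNReal.ofReal_tsum_of_nonneg
    (fun y => mul_nonneg NNReal.zero_le_coe (r.hitProb_nonneg B A y))
    (r.summable_rate_mul_hitProb B A x), ← r.holdingRate_mul_preimage_pathShift]
  rcases eq_or_ne (r.holdingRate x) 0 with h | h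
  · rw [h, ENNReal.coe_zero, zero_mul, zero_mul]
  · exact congrArg _ (r.law_returnTime_lt (fun _ => hr.holdingRate_pos) hAB.symm h)

/-- The capacity is the energy of the equilibrium potential. -/
lemma capacity_eq (hr : r.Irreducible) (μ : E → ℝ≥0) (hAB : Disjoint A B) (hB : Bᶜ.Finite) :
    r.capacity μ A B =
      ENNReal.ofReal (-pairing μ (r.generator (r.hitProb A B)) (r.hitProb A B)) := by
  set V := r.hitProb A B with hV
  let e : E → ℝ := fun x => -((μ x : ℝ) * r.generator V x * V x)
  have hA : A.Finite := hB.subset fun x hx => Set.disjoint_left.1 hAB hx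
  -- On `B` the factor `V` vanishes, and off `A ∪ B` the factor `L V` does.
  have hsupp : Function.support e ⊆ A := by
    intro x hx
    by_contra hxA
    refine hx ?_
    by_cases hxB : x ∈ B
    · simp [e, hV, r.hitProb_of_mem_right hAB hxB]
    · simp [e, hV, r.generator_hitProb A B hxA hxB]
  have hterm : ∀ x ∈ A, ((μ x * r.holdingRate x : ℝ≥0) : ℝ≥0∞) *
      r.law x {ω | r.returnTime A ω > r.returnTime B ω} = ENNReal.ofReal (e x) := by
    intro x hx
    rw [ENNReal.coe_mul, mul_assoc, r.holdingRate_mul_law_returnTime hr hAB hB hx,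
      ← ENNReal.ofReal_coe_nnreal, ← ENNReal.ofReal_mul NNReal.zero_le_coe]
    simp [e, hV, r.hitProb_of_mem_left B hx]
  have he : ∀ x, 0 ≤ e x := by
    intro x
    by_cases hx : x ∈ A
    · have h : -r.generator V x = ∑' y, (r.rate x y : ℝ) * (1 - V y) := by
        rw [generator, ← tsum_neg]
        refine tsum_congr fun y => ?_
        rw [hV, r.hitProb_of_mem_left B hx]
        ring
      have h' : 0 ≤ -r.generator V x := by
        rw [h]
        exact tsum_nonneg fun y => mul_nonneg NNReal.zero_le_coe
          (sub_nonneg.2 (r.hitProb_le_one A B y))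
      have := mul_nonneg (mul_nonneg (NNReal.zero_le_coe (q := μ x)) h') (r.hitProb_nonneg A B x)
      simpa [e] using this
    · exact (Function.notMem_support.1 fun h => hx (hsupp h)).ge
  have hsum : Summable e := summable_of_hasFiniteSupport (hA.subset hsupp)
  calc r.capacity μ A B = ∑' x : A, ENNReal.ofReal (e x) := tsum_congr fun x => hterm x x.2
    _ = ∑' x, ENNReal.ofReal (e x) :=
      tsum_subtype_eq_of_support_subset (f := fun x => ENNReal.ofReal (e x))
        fun x hx => hsupp fun h => hx (by simp [h])
    _ = ENNReal.ofReal (∑' x, e x) := (ENNReal.ofReal_tsum_of_nonneg he hsum).symm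
    _ = _ := by rw [tsum_neg]; rfl

end Potential

end JumpRates

namespace JumpRates

/-! ### The time-reversed chain -/

section Stationary

variable {E : Type*} {r : JumpRates E} {μ : E → ℝ≥0}

/-- By balance, a zero of `μ` forces zeros at all states that jump into it; by irreducibility `μ`
would vanish everywhere. -/
lemma IsStationary.pos (hμ : r.IsStationary μ) (hr : r.Irreducible) (x : E) : 0 < μ x := by
  by_contra hx
  have hx : μ x = 0 := by simpa using hx
  refine hμ.ne_zero (funext fun y => ?_)
  induction hr y x using Relation.ReflTransGen.head_induction_on with
  | refl => exact hx
  | @head a c hac _ ih =>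
    have h := hμ.balance c
    rw [show μ c = 0 from ih, zero_mul, hasSum_zero_iff] at h
    exact (mul_eq_zero.1 (h a)).resolve_right hac.ne'

lemma mul_adjoint_rate (hμ : r.IsStationary μ) (hpos : ∀ x, 0 < μ x) (x y : E) :
    μ x * (r.adjoint μ hμ).rate x y = μ y * r.rate y x :=
  mul_div_cancel₀ _ (hpos x).ne'

lemma adjoint_holdingRate (hμ : r.IsStationary μ) (hpos : ∀ x, 0 < μ x) (x : E) :
    (r.adjoint μ hμ).holdingRate x = r.holdingRate x := by
  have h := (hμ.balance x).tsum_eq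
  refine mul_left_cancel₀ (hpos x).ne' (h ▸ ?_)
  rw [holdingRate, ← NNReal.tsum_mul_left]
  exact tsum_congr fun y => mul_adjoint_rate hμ hpos x y

lemma adjoint_isStationary (hμ : r.IsStationary μ) (hpos : ∀ x, 0 < μ x) :
    (r.adjoint μ hμ).IsStationary μ where
  ne_zero := hμ.ne_zero
  balance x := by
    simp_rw [mul_adjoint_rate hμ hpos, adjoint_holdingRate hμ hpos]
    exact (r.summable_rate x).hasSum.mul_left (μ x)

lemma adjoint_irreducible (hμ : r.IsStationary μ) (hpos : ∀ x, 0 < μ x) (hr : r.Irreducible) :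
    (r.adjoint μ hμ).Irreducible := by
  intro x y
  induction hr y x with
  | refl => exact .refl
  | @tail b c _ hbc ih => exact .head (div_pos (mul_pos (hpos b) hbc) (hpos c)) ih

end Stationary

/-! ### The bilinear form of the generator -/

section Form

variable {E : Type*} {r : JumpRates E} {μ : E → ℝ≥0} {B : Set E} {F G H : E → ℝ}

/-- A bounded function that vanishes outside a finite set `s` is moved by the generator to a
finite combination of the columns of the rate matrix. -/
lemma generator_eq_sum {s : Finset E} (hF : ∀ x ∉ s, F x = 0) (x : E) :
    r.generator F x = ∑ z ∈ s, (r.rate x z : ℝ) * F z - r.holdingRate x * F x := by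
  have h : ∀ z ∉ s, (r.rate x z : ℝ) * F z = 0 := fun z hz => by rw [hF z hz, mul_zero]
  rw [r.generator_eq_sub x (summable_of_ne_finset_zero h), tsum_eq_sum h]

/-- The sum splits into finitely many column sums `∑_x μ(x) r(x, z) H(x)`; each converges absolutely
because balance makes the column summable and `H` is bounded. -/
lemma hasSum_weighted_generator (hμ : r.IsStationary μ) {s : Finset E} (hF : ∀ x ∉ s, F x = 0)
    {C : ℝ} (hH : ∀ x, |H x| ≤ C) :
    HasSum (fun x => (μ x : ℝ) * r.generator F x * H x)
      (∑ z ∈ s, ((∑' x, (μ x * r.rate x z : ℝ) * H x) * F z - μ z * r.holdingRate z * F z * H z))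
    := by
  have h₁ : ∀ z, Summable fun x => (μ x * r.rate x z : ℝ) * H x := fun z => by
    have hz := NNReal.summable_coe.2 (hμ.balance z).summable
    refine .of_norm_bounded (hz.mul_right C) fun x => ?_
    rw [norm_mul, Real.norm_eq_abs, Real.norm_eq_abs, ← NNReal.coe_mul, NNReal.abs_eq]
    exact mul_le_mul_of_nonneg_left (hH x) NNReal.zero_le_coe
  have h₂ := hasSum_sum fun z (_ : z ∈ s) => (h₁ z).hasSum.mul_right (F z)
  have h₃ : HasSum (fun x => (μ x : ℝ) * r.holdingRate x * F x * H x)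
      (∑ z ∈ s, (μ z : ℝ) * r.holdingRate z * F z * H z) :=
    hasSum_sum_of_ne_finset_zero fun x hx => by rw [hF x hx]; ring
  rw [Finset.sum_sub_distrib]
  refine (h₂.sub h₃).congr_fun fun x => ?_
  rw [generator_eq_sum hF, mul_sub, sub_mul, Finset.mul_sum, Finset.sum_mul]
  refine congrArg₂ _ (Finset.sum_congr rfl fun z _ => by ring) (by ring)

lemma exists_sub_of_constOn (hF : ConstOn B F) (hB : Bᶜ.Finite) :
    ∃ c, (∀ x ∈ B, F x = c) ∧ (∀ x ∉ hB.toFinset, F x - c = 0) ∧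
      ∀ r : JumpRates E, r.generator (fun x => F x - c) = r.generator F := by
  obtain ⟨c, hc⟩ := hF
  refine ⟨c, hc, fun x hx => ?_, fun r => ?_⟩
  · rw [hc x (by simpa using hx), sub_self]
  · funext x
    exact tsum_congr fun y => by ring

lemma summable_weighted_generator (hμ : r.IsStationary μ) (hB : Bᶜ.Finite) (hF : ConstOn B F)
    (hH : ConstOn B H) : Summable fun x => (μ x : ℝ) * r.generator F x * H x := by
  obtain ⟨c, -, hc, hgen⟩ := exists_sub_of_constOn hF hB
  obtain ⟨C, hC⟩ := hH.exists_abs_le hB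
  simpa only [hgen] using (hasSum_weighted_generator hμ hc hC).summable

/-- The bilinear form `⟨L F, H⟩_μ`. -/
noncomputable def form (r : JumpRates E) (μ : E → ℝ≥0) (F H : E → ℝ) : ℝ :=
  pairing μ (r.generator F) H

lemma form_linearComb_left (hμ : r.IsStationary μ) (hB : Bᶜ.Finite) (hF : ConstOn B F)
    (hG : ConstOn B G) (hH : ConstOn B H) (a b : ℝ) :
    r.form μ (fun x => a * F x + b * G x) H = a * r.form μ F H + b * r.form μ G H := by
  have h₁ := summable_weighted_generator hμ hB hF hH
  have h₂ := summable_weighted_generator hμ hB hG hH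
  rw [form, form, form, pairing, pairing, pairing, ← tsum_mul_left, ← tsum_mul_left,
    ← (h₁.mul_left a).tsum_add (h₂.mul_left b)]
  refine tsum_congr fun x => ?_
  rw [r.generator_linearComb hB hF hG]
  ring

lemma form_linearComb_right (hμ : r.IsStationary μ) (hB : Bᶜ.Finite) (hF : ConstOn B F)
    (hG : ConstOn B G) (hH : ConstOn B H) (a b : ℝ) :
    r.form μ F (fun x => a * G x + b * H x) = a * r.form μ F G + b * r.form μ F H := by
  have h₁ := summable_weighted_generator hμ hB hF hG
  have h₂ := summable_weighted_generator hμ hB hF hH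
  rw [form, form, form, pairing, pairing, pairing, ← tsum_mul_left, ← tsum_mul_left,
    ← (h₁.mul_left a).tsum_add (h₂.mul_left b)]
  exact tsum_congr fun x => by ring

lemma form_congr_right (h : ∀ x, r.generator F x = 0 ∨ G x = H x) :
    r.form μ F G = r.form μ F H :=
  tsum_congr fun x => by rcases h x with h | h <;> simp [h]

/-- The columns `μ(x) r(x, z)` of one chain are the rows `μ(z) r*(z, x)` of the other, and the
holding rates agree. -/
lemma form_eq_form_adjoint_of_finite (hμ : r.IsStationary μ) (hpos : ∀ x, 0 < μ x)
    (hB : Bᶜ.Finite) (hF : ∀ x ∉ hB.toFinset, F x = 0) (hH : ConstOn B H) :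
    r.form μ F H = (r.adjoint μ hμ).form μ H F := by
  obtain ⟨C, hC⟩ := hH.exists_abs_le hB
  rw [form, pairing, (hasSum_weighted_generator hμ hF hC).tsum_eq, form, pairing,
    tsum_eq_sum fun x hx => by rw [hF x hx, mul_zero]]
  refine Finset.sum_congr rfl fun z _ => ?_
  rw [(r.adjoint μ hμ).generator_eq_sub z ((r.adjoint μ hμ).summable_rate_mul hB hH z),
    adjoint_holdingRate hμ hpos, mul_sub, sub_mul, ← tsum_mul_left]
  refine congrArg₂ _ (congrArg (· * F z) (tsum_congr fun x => ?_)) (by ring)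
  rw [← mul_assoc, ← NNReal.coe_mul, ← NNReal.coe_mul, mul_adjoint_rate hμ hpos]

lemma form_const_left (c : ℝ) : r.form μ (fun _ => c) H = 0 := by
  simp [form, pairing, generator_const]

/-- Centre `F` to finite support, then move the generator onto the constant. -/
lemma form_const_right (hμ : r.IsStationary μ) (hpos : ∀ x, 0 < μ x) (hB : Bᶜ.Finite)
    (hF : ConstOn B F) (c : ℝ) : r.form μ F (fun _ => c) = 0 := by
  obtain ⟨d, -, hd, hgen⟩ := exists_sub_of_constOn hF hB
  have h := form_eq_form_adjoint_of_finite hμ hpos hB hd (constOn_const B c)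
  rwa [form_const_left, form, hgen] at h

/-- The generators of the chain and of its time reversal are adjoint to each other. -/
lemma form_eq_form_adjoint (hμ : r.IsStationary μ) (hpos : ∀ x, 0 < μ x) (hB : Bᶜ.Finite)
    (hF : ConstOn B F) (hH : ConstOn B H) : r.form μ F H = (r.adjoint μ hμ).form μ H F := by
  obtain ⟨c, -, hc, hgen⟩ := exists_sub_of_constOn hF hB
  have hμ' := adjoint_isStationary hμ hpos
  have h := form_eq_form_adjoint_of_finite hμ hpos hB hc hH
  rw [form, hgen] at h
  have hsub : (fun x => F x - c) = fun x => 1 * F x + (-1) * c := by funext x; ring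
  rw [hsub, form_linearComb_right hμ' hB hH hF (constOn_const B c),
    form_const_right hμ' hpos hB hH] at h
  rw [form, h]
  ring

/-- After centring, bound `G x * G z` by `(G x ^ 2 + G z ^ 2) / 2`. The row sums of `μ(x) r(x, z)`
over `s` are at most `μ λ` by definition, the column sums by stationarity; each pays for half of the
diagonal term. -/
lemma form_self_nonpos (hμ : r.IsStationary μ) (hpos : ∀ x, 0 < μ x) (hB : Bᶜ.Finite)
    (hF : ConstOn B F) : r.form μ F F ≤ 0 := by
  obtain ⟨c, hcB, hc, hgen⟩ := exists_sub_of_constOn hF hB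
  set G : E → ℝ := fun x => F x - c with hG
  set s := hB.toFinset
  replace hc : ∀ x ∉ s, G x = 0 := hc
  have hGF : r.form μ F F = r.form μ G G := by
    have hF' : F = fun x => 1 * G x + 1 * c := by funext x; simp [hG]
    have hGB : ConstOn B G := ⟨0, fun x hx => by simp [hG, hcB x hx]⟩
    have hgen' : r.form μ F = r.form μ G := by funext H; rw [form, form, hgen]
    rw [hgen']
    conv_lhs => rw [hF']
    rw [form_linearComb_right hμ hB hGB hGB (constOn_const B c), form_const_right hμ hpos hB hGB]
    ring
  clear_value G
  have hrow : ∀ x, ∑ z ∈ s, (μ x * r.rate x z : ℝ) ≤ μ x * r.holdingRate x := fun x => by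
    rw [← Finset.mul_sum, ← r.tsum_coe_rate]
    exact mul_le_mul_of_nonneg_left ((NNReal.summable_coe.2 (r.summable_rate x)).sum_le_tsum s
      fun _ _ => NNReal.zero_le_coe) NNReal.zero_le_coe
  have hcol : ∀ z, ∑ x ∈ s, (μ x * r.rate x z : ℝ) ≤ μ z * r.holdingRate z := fun z =>
    sum_le_hasSum s (fun _ _ => mul_nonneg NNReal.zero_le_coe NNReal.zero_le_coe)
      (by exact_mod_cast hμ.balance z)
  have hsum : r.form μ G G =
      ∑ x ∈ s, ∑ z ∈ s, (μ x * r.rate x z : ℝ) * (G x * G z) -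
        ∑ x ∈ s, (μ x * r.holdingRate x : ℝ) * G x ^ 2 := by
    rw [form, pairing, tsum_eq_sum (s := s) fun x hx => by rw [hc x hx, mul_zero],
      ← Finset.sum_sub_distrib]
    refine Finset.sum_congr rfl fun x _ => ?_
    rw [generator_eq_sum hc, mul_sub, sub_mul, Finset.mul_sum, Finset.sum_mul]
    exact congrArg₂ _ (Finset.sum_congr rfl fun z _ => by ring) (by ring)
  have hle : ∑ x ∈ s, ∑ z ∈ s, (μ x * r.rate x z : ℝ) * (G x * G z) ≤
      ∑ x ∈ s, ∑ z ∈ s, ((μ x * r.rate x z : ℝ) * (G x ^ 2 / 2) +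
        (μ x * r.rate x z : ℝ) * (G z ^ 2 / 2)) := by
    refine Finset.sum_le_sum fun x _ => Finset.sum_le_sum fun z _ => ?_
    rw [← mul_add]
    refine mul_le_mul_of_nonneg_left ?_ (mul_nonneg NNReal.zero_le_coe NNReal.zero_le_coe)
    linarith [two_mul_le_add_sq (G x) (G z)]
  have h₁ : ∑ x ∈ s, ∑ z ∈ s, (μ x * r.rate x z : ℝ) * (G x ^ 2 / 2) ≤
      ∑ x ∈ s, (μ x * r.holdingRate x : ℝ) * (G x ^ 2 / 2) :=
    Finset.sum_le_sum fun x _ => by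
      rw [← Finset.sum_mul]
      exact mul_le_mul_of_nonneg_right (hrow x) (by positivity)
  have h₂ : ∑ x ∈ s, ∑ z ∈ s, (μ x * r.rate x z : ℝ) * (G z ^ 2 / 2) ≤
      ∑ x ∈ s, (μ x * r.holdingRate x : ℝ) * (G x ^ 2 / 2) := by
    rw [Finset.sum_comm]
    refine Finset.sum_le_sum fun z _ => ?_
    rw [← Finset.sum_mul]
    exact mul_le_mul_of_nonneg_right (hcol z) (by positivity)
  have h₃ : ∑ x ∈ s, (μ x * r.holdingRate x : ℝ) * G x ^ 2 =
      ∑ x ∈ s, (μ x * r.holdingRate x : ℝ) * (G x ^ 2 / 2) +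
        ∑ x ∈ s, (μ x * r.holdingRate x : ℝ) * (G x ^ 2 / 2) := by
    rw [← Finset.sum_add_distrib]
    exact Finset.sum_congr rfl fun x _ => by ring
  simp_rw [Finset.sum_add_distrib] at hle
  rw [hGF, hsum]
  linarith

lemma form_single (F : E → ℝ) (x : E) [DecidableEq E] :
    r.form μ F (Pi.single x 1) = μ x * r.generator F x := by
  rw [form, pairing, tsum_eq_single x fun y hy => by rw [Pi.single_eq_of_ne hy, mul_zero],
    Pi.single_eq_same, mul_one]

lemma summable_weighted_symmGenerator (hμ : r.IsStationary μ) (hpos : ∀ x, 0 < μ x)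
    (hB : Bᶜ.Finite) (hH : ConstOn B H) :
    Summable fun x => (μ x : ℝ) * H x * -symmGenerator r μ hμ H x := by
  refine (((summable_weighted_generator hμ hB hH hH).add (summable_weighted_generator
    (adjoint_isStationary hμ hpos) hB hH hH)).mul_left (-1 / 2)).congr fun x => ?_
  rw [symmGenerator]
  ring

/-- On the diagonal, adjointness makes the forms of `L` and `L*` coincide, so `S` may be replaced by
`L*`. -/
lemma dirichletFunctional_eq (hμ : r.IsStationary μ) (hpos : ∀ x, 0 < μ x) (hB : Bᶜ.Finite)
    (F : E → ℝ) (hH : ConstOn B H) :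
    dirichletFunctional r μ hμ F H =
      2 * (r.adjoint μ hμ).form μ F H + (r.adjoint μ hμ).form μ H H := by
  have h : pairing μ H (fun x => -symmGenerator r μ hμ H x) = -(r.adjoint μ hμ).form μ H H := by
    have h₁ := summable_weighted_generator hμ hB hH hH
    have h₂ := summable_weighted_generator (adjoint_isStationary hμ hpos) hB hH hH
    have h₃ : pairing μ H (fun x => -symmGenerator r μ hμ H x) =
        -1 / 2 * (r.form μ H H + (r.adjoint μ hμ).form μ H H) := by
      rw [form, form, pairing, pairing, pairing, ← h₁.tsum_add h₂, ← tsum_mul_left]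
      refine tsum_congr fun x => ?_
      rw [symmGenerator]
      ring
    rw [h₃, form_eq_form_adjoint hμ hpos hB hH hH]
    ring
  rw [dirichletFunctional, h, sub_neg_eq_add]
  rfl

end Form

end JumpRates

namespace JumpRates

/-! ### The variational argument -/

section Variational

variable {E : Type*} {r : JumpRates E} {μ : E → ℝ≥0} {A B : Set E} {F K V W : E → ℝ}

lemma constOn_of_mem_boundaryFunctions (hF : F ∈ boundaryFunctions A B) : ConstOn B F :=
  ⟨0, hF.2⟩

lemma boundaryFunctions_subset_testFunctions : boundaryFunctions A B ⊆ testFunctions A B :=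
  fun _ hF => ⟨⟨1, hF.1⟩, 0, hF.2⟩

/-- Against a function that is harmonic outside `A ∪ B`, a test function only matters through its
values on `A` and `B`. -/
lemma form_of_harmonic (hμ : r.IsStationary μ) (hpos : ∀ x, 0 < μ x) (hB : Bᶜ.Finite)
    (hV : ConstOn B V) (hharm : ∀ x ∉ A ∪ B, r.generator V x = 0)
    (hW : W ∈ boundaryFunctions A B) {a b : ℝ} (ha : ∀ x ∈ A, K x = a) (hb : ∀ x ∈ B, K x = b) :
    r.form μ V K = (a - b) * r.form μ V W := by
  have h : r.form μ V K = r.form μ V (fun x => (a - b) * W x + 1 * b) := by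
    refine form_congr_right fun x => ?_
    by_cases hx : x ∈ A ∪ B
    · rcases hx with hx | hx
      · right; rw [ha x hx, hW.1 x hx]; ring
      · right; rw [hb x hx, hW.2 x hx]; ring
    · exact .inl (hharm x hx)
  rw [h, form_linearComb_right hμ hB hV (constOn_of_mem_boundaryFunctions hW) (constOn_const B b),
    form_const_right hμ hpos hB hV]
  ring

/-- The potentials `V` of the chain and `W` of its time reversal induce the same linear functional
on the test functions. -/
lemma form_adjoint_comm_of_harmonic (hμ : r.IsStationary μ) (hpos : ∀ x, 0 < μ x)
    (hB : Bᶜ.Finite) (hV : V ∈ boundaryFunctions A B) (hW : W ∈ boundaryFunctions A B)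
    (hVharm : ∀ x ∉ A ∪ B, r.generator V x = 0)
    (hWharm : ∀ x ∉ A ∪ B, (r.adjoint μ hμ).generator W x = 0) (hK : K ∈ testFunctions A B) :
    (r.adjoint μ hμ).form μ W K = (r.adjoint μ hμ).form μ K V := by
  obtain ⟨⟨a, ha⟩, b, hb⟩ := hK
  have hVB := constOn_of_mem_boundaryFunctions hV
  have hWB := constOn_of_mem_boundaryFunctions hW
  -- The two sides reduce to `(a - b) ⟨L* W, V⟩_μ` and `(a - b) ⟨L V, W⟩_μ`.
  rw [form_of_harmonic (adjoint_isStationary hμ hpos) hpos hB hWB hWharm hV ha hb,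
    ← form_eq_form_adjoint hμ hpos hB hVB ⟨b, hb⟩,
    form_of_harmonic hμ hpos hB hVB hVharm hW ha hb, form_eq_form_adjoint hμ hpos hB hVB hWB]

lemma form_adjoint_boundary (hμ : r.IsStationary μ) (hpos : ∀ x, 0 < μ x)
    (hB : Bᶜ.Finite) (hV : V ∈ boundaryFunctions A B)
    (hVharm : ∀ x ∉ A ∪ B, r.generator V x = 0) (hF : F ∈ boundaryFunctions A B) :
    (r.adjoint μ hμ).form μ F V = (r.adjoint μ hμ).form μ V V := by
  have hVB := constOn_of_mem_boundaryFunctions hV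
  rw [← form_eq_form_adjoint hμ hpos hB hVB (constOn_of_mem_boundaryFunctions hF),
    ← form_eq_form_adjoint hμ hpos hB hVB hVB,
    form_of_harmonic hμ hpos hB hVB hVharm hV hF.1 hF.2, sub_zero, one_mul]

/-- `-V` is spelled as a linear combination so that the bilinearity lemmas apply verbatim. -/
lemma neg_mem_testFunctions (hV : V ∈ testFunctions A B) :
    (fun x => (-1) * V x + 0 * V x) ∈ testFunctions A B := by
  obtain ⟨hA, hB⟩ := hV
  exact ⟨ConstOn.linearComb hA hA _ _, ConstOn.linearComb hB hB _ _⟩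

/-- Testing with `-V` gives the energy of `V`. -/
lemma dirichletFunctional_neg_potential (hμ : r.IsStationary μ) (hpos : ∀ x, 0 < μ x)
    (hB : Bᶜ.Finite) (hV : V ∈ boundaryFunctions A B)
    (hVharm : ∀ x ∉ A ∪ B, r.generator V x = 0) (hF : F ∈ boundaryFunctions A B) :
    dirichletFunctional r μ hμ F (fun x => (-1) * V x + 0 * V x) =
      -(r.adjoint μ hμ).form μ V V := by
  have hμ' := adjoint_isStationary hμ hpos
  have hVB := constOn_of_mem_boundaryFunctions hV
  have hFB := constOn_of_mem_boundaryFunctions hF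
  rw [dirichletFunctional_eq hμ hpos hB F (hVB.linearComb hVB _ _),
    form_linearComb_right hμ' hB hFB hVB hVB,
    form_linearComb_left hμ' hB hVB hVB (hVB.linearComb hVB _ _),
    form_linearComb_right hμ' hB hVB hVB hVB, form_adjoint_boundary hμ hpos hB hV hVharm hF]
  ring

lemma le_supFunctional (hμ : r.IsStationary μ) (hpos : ∀ x, 0 < μ x)
    (hB : Bᶜ.Finite) (hV : V ∈ boundaryFunctions A B)
    (hVharm : ∀ x ∉ A ∪ B, r.generator V x = 0) (hF : F ∈ boundaryFunctions A B) :
    ((-(r.adjoint μ hμ).form μ V V : ℝ) : EReal) ≤ supFunctional r μ hμ A B F := by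
  rw [← dirichletFunctional_neg_potential hμ hpos hB hV hVharm hF]
  exact le_iSup₂_of_le _ (neg_mem_testFunctions (boundaryFunctions_subset_testFunctions hV)) le_rfl

lemma form_average (hμ : r.IsStationary μ) (hpos : ∀ x, 0 < μ x)
    (hB : Bᶜ.Finite) (hV : V ∈ boundaryFunctions A B) (hW : W ∈ boundaryFunctions A B)
    (hVharm : ∀ x ∉ A ∪ B, r.generator V x = 0)
    (hWharm : ∀ x ∉ A ∪ B, (r.adjoint μ hμ).generator W x = 0) (hK : K ∈ testFunctions A B) :
    2 * (r.adjoint μ hμ).form μ (fun x => (V x + W x) / 2) K =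
      (r.adjoint μ hμ).form μ V K + (r.adjoint μ hμ).form μ K V := by
  have havg : (fun x => (V x + W x) / 2) = fun x => (1 / 2) * V x + (1 / 2) * W x := by
    funext x; ring
  rw [havg, form_linearComb_left (adjoint_isStationary hμ hpos) hB
    (constOn_of_mem_boundaryFunctions hV) (constOn_of_mem_boundaryFunctions hW) hK.2,
    form_adjoint_comm_of_harmonic hμ hpos hB hV hW hVharm hWharm hK]
  ring

lemma average_mem_boundaryFunctions (hV : V ∈ boundaryFunctions A B)
    (hW : W ∈ boundaryFunctions A B) : (fun x => (V x + W x) / 2) ∈ boundaryFunctions A B :=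
  ⟨fun x hx => by simp only [hV.1 x hx, hW.1 x hx]; norm_num,
    fun x hx => by simp only [hV.2 x hx, hW.2 x hx]; norm_num⟩

lemma supFunctional_average (hμ : r.IsStationary μ) (hpos : ∀ x, 0 < μ x)
    (hB : Bᶜ.Finite) (hV : V ∈ boundaryFunctions A B) (hW : W ∈ boundaryFunctions A B)
    (hVharm : ∀ x ∉ A ∪ B, r.generator V x = 0)
    (hWharm : ∀ x ∉ A ∪ B, (r.adjoint μ hμ).generator W x = 0) :
    supFunctional r μ hμ A B (fun x => (V x + W x) / 2) =
      ((-(r.adjoint μ hμ).form μ V V : ℝ) : EReal) := by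
  refine le_antisymm (iSup₂_le fun H hH => EReal.coe_le_coe_iff.2 ?_)
    (le_supFunctional hμ hpos hB hV hVharm (average_mem_boundaryFunctions hV hW))
  have hμ' := adjoint_isStationary hμ hpos
  have hVB := constOn_of_mem_boundaryFunctions hV
  have hHB : ConstOn B H := hH.2
  have hVH := hVB.linearComb hHB 1 1
  -- Completing the square: the functional exceeds `-a(V, V)` by exactly `a(V + H, V + H)`.
  have hnonpos := form_self_nonpos hμ' hpos hB hVH
  rw [form_linearComb_left hμ' hB hVB hHB hVH, form_linearComb_right hμ' hB hVB hVB hHB,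
    form_linearComb_right hμ' hB hHB hVB hHB] at hnonpos
  rw [dirichletFunctional_eq hμ hpos hB _ hHB,
    form_average hμ hpos hB hV hW hVharm hWharm hH]
  linarith

/-- A linear function of `t` that is dominated by a multiple of `t ^ 2` vanishes. -/
lemma eq_zero_of_forall_mul_le {β γ : ℝ} (h : ∀ t : ℝ, t * β ≤ t ^ 2 * γ) : β = 0 := by
  by_contra hβ
  have hβ2 : 0 < β ^ 2 := by positivity
  have hγ : 0 < |γ| + 1 := by positivity
  -- For this `t` the inequality forces `|γ| + 1 ≤ γ` unless `β = 0`.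
  have h' := h (β / (|γ| + 1))
  rw [div_pow, div_mul_eq_mul_div, div_mul_eq_mul_div, div_le_div_iff₀ hγ (by positivity)] at h'
  have h₁ : β ^ 2 * (|γ| + 1) * (|γ| + 1 - γ) ≤ 0 := by nlinarith
  have h₂ : 0 < |γ| + 1 - γ := by linarith [le_abs_self γ]
  have := mul_pos (mul_pos hβ2 hγ) h₂
  linarith

/-- The Euler–Lagrange equation: `H = -V + t K` already reaches the bound at `t = 0`, so the term
linear in `t` must vanish. -/
lemma form_eq_of_supFunctional_le (hμ : r.IsStationary μ) (hpos : ∀ x, 0 < μ x)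
    (hB : Bᶜ.Finite) (hV : V ∈ boundaryFunctions A B)
    (hVharm : ∀ x ∉ A ∪ B, r.generator V x = 0) (hF : F ∈ boundaryFunctions A B)
    (hsup : supFunctional r μ hμ A B F ≤ ((-(r.adjoint μ hμ).form μ V V : ℝ) : EReal))
    (hK : K ∈ testFunctions A B) :
    2 * (r.adjoint μ hμ).form μ F K =
      (r.adjoint μ hμ).form μ V K + (r.adjoint μ hμ).form μ K V := by
  have hμ' := adjoint_isStationary hμ hpos
  have hVB := constOn_of_mem_boundaryFunctions hV
  have hFB := constOn_of_mem_boundaryFunctions hF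
  have hKB : ConstOn B K := hK.2
  have hVt := boundaryFunctions_subset_testFunctions hV
  refine sub_eq_zero.1 (eq_zero_of_forall_mul_le (γ := -(r.adjoint μ hμ).form μ K K) fun t => ?_)
  have hHB := hVB.linearComb hKB (-1) t
  have hle := EReal.coe_le_coe_iff.1 ((le_iSup₂_of_le (fun x => (-1) * V x + t * K x)
    ⟨ConstOn.linearComb hVt.1 hK.1 _ _, hHB⟩ le_rfl).trans hsup)
  rw [dirichletFunctional_eq hμ hpos hB F hHB, form_linearComb_right hμ' hB hFB hVB hKB,
    form_linearComb_left hμ' hB hVB hKB hHB, form_linearComb_right hμ' hB hVB hVB hKB,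
    form_linearComb_right hμ' hB hKB hVB hKB, form_adjoint_boundary hμ hpos hB hV hVharm hF] at hle
  linarith

/-- The minimizer of the functional `F ↦ sup_H` is unique. -/
lemma eq_average_of_supFunctional_le (hμ : r.IsStationary μ) (hpos : ∀ x, 0 < μ x)
    (hr : r.Irreducible) (hB : Bᶜ.Finite) (hne : (A ∪ B).Nonempty)
    (hV : V ∈ boundaryFunctions A B) (hW : W ∈ boundaryFunctions A B)
    (hVharm : ∀ x ∉ A ∪ B, r.generator V x = 0)
    (hWharm : ∀ x ∉ A ∪ B, (r.adjoint μ hμ).generator W x = 0) (hF : F ∈ boundaryFunctions A B)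
    (hsup : supFunctional r μ hμ A B F ≤ ((-(r.adjoint μ hμ).form μ V V : ℝ) : EReal)) :
    F = fun x => (V x + W x) / 2 := by
  classical
  set F₀ : E → ℝ := fun x => (V x + W x) / 2
  have hF₀ : F₀ ∈ boundaryFunctions A B := average_mem_boundaryFunctions hV hW
  have hFB := constOn_of_mem_boundaryFunctions hF
  have hF₀B := constOn_of_mem_boundaryFunctions hF₀
  have key := (r.adjoint μ hμ).eq_zero_of_generator_eq_zero
    (f := fun x => 1 * F x + (-1) * F₀ x) (adjoint_irreducible hμ hpos hr) hne
    (hB.subset (Set.compl_subset_compl.2 Set.subset_union_right)) ?_ ?_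
  · funext x
    linarith [key x]
  · rintro x (hx | hx)
    · rw [hF.1 x hx, hF₀.1 x hx]; ring
    · rw [hF.2 x hx, hF₀.2 x hx]; ring
  · intro x hx
    rw [Set.mem_union, not_or] at hx
    -- A point mass off `A ∪ B` is a test function, and it reads off `L* F` at `x`.
    have hK : (Pi.single x 1 : E → ℝ) ∈ testFunctions A B :=
      ⟨⟨0, fun y hy => Pi.single_eq_of_ne (ne_of_mem_of_not_mem hy hx.1) _⟩,
        0, fun y hy => Pi.single_eq_of_ne (ne_of_mem_of_not_mem hy hx.2) _⟩
    have h₁ := form_eq_of_supFunctional_le hμ hpos hB hV hVharm hF hsup hK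
    rw [← form_average hμ hpos hB hV hW hVharm hWharm hK, form_single, form_single] at h₁
    have h₂ := mul_left_cancel₀ (NNReal.coe_ne_zero.2 (hpos x).ne')
      (mul_left_cancel₀ two_ne_zero h₁)
    rw [(r.adjoint μ hμ).generator_linearComb hB hFB hF₀B, h₂]
    ring

end Variational

lemma hitProb_mem_boundaryFunctions {E : Type*} [Countable E] [MeasurableSpace E]
    [DiscreteMeasurableSpace E] (r : JumpRates E) {A B : Set E} (hAB : Disjoint A B) :
    r.hitProb A B ∈ boundaryFunctions A B :=
  ⟨fun _ hx => r.hitProb_of_mem_left B hx, fun _ hx => r.hitProb_of_mem_right hAB hx⟩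

end JumpRates

end MarkovDirichlet

theorem theorem2p2 {E : Type*} [Countable E] [MeasurableSpace E] [DiscreteMeasurableSpace E]
    (r : MarkovDirichlet.JumpRates E) (hr : r.Irreducible)
    (μ : E → NNReal) (hμ : r.IsStationary μ)
    (A B : Set E) (hAB : Disjoint A B) (hB : Bᶜ.Finite) :
    -- the two pairings are absolutely convergent sums
    (∀ F ∈ MarkovDirichlet.boundaryFunctions A B, ∀ H ∈ MarkovDirichlet.testFunctions A B,
      Summable (fun x => (μ x : ℝ) * (r.adjoint μ hμ).generator F x * H x) ∧
      Summable (fun x => (μ x : ℝ) * H x * -MarkovDirichlet.symmGenerator r μ hμ H x)) ∧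
    -- the variational formula
    ((r.capacity μ A B : EReal) =
      ⨅ F ∈ MarkovDirichlet.boundaryFunctions A B, ⨆ H ∈ MarkovDirichlet.testFunctions A B,
        (MarkovDirichlet.dirichletFunctional r μ hμ F H : EReal)) ∧
    -- the average of the two equilibrium potentials is admissible and attains the infimum
    (fun x => (r.equilibriumPotential A B x + (r.adjoint μ hμ).equilibriumPotential A B x) / 2) ∈
      MarkovDirichlet.boundaryFunctions A B ∧
    MarkovDirichlet.supFunctional r μ hμ A B
      (fun x => (r.equilibriumPotential A B x + (r.adjoint μ hμ).equilibriumPotential A B x) / 2)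
      = (r.capacity μ A B : EReal) ∧
    -- and it is the only minimizer, as soon as there is a boundary condition
    ((A ∪ B).Nonempty → ∀ F ∈ MarkovDirichlet.boundaryFunctions A B,
      MarkovDirichlet.supFunctional r μ hμ A B F = (r.capacity μ A B : EReal) →
      F = fun x =>
        (r.equilibriumPotential A B x + (r.adjoint μ hμ).equilibriumPotential A B x) / 2) := by
  open MarkovDirichlet JumpRates in
  have hpos := hμ.pos hr
  have hμ' := adjoint_isStationary hμ hpos
  simp_rw [r.equilibriumPotential_eq_hitProb hr hAB,
    (r.adjoint μ hμ).equilibriumPotential_eq_hitProb (adjoint_irreducible hμ hpos hr) hAB]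
  have hV := r.hitProb_mem_boundaryFunctions hAB
  have hW := (r.adjoint μ hμ).hitProb_mem_boundaryFunctions hAB
  have hVharm : ∀ x ∉ A ∪ B, r.generator (r.hitProb A B) x = 0 := fun x hx =>
    r.generator_hitProb A B (fun h => hx (.inl h)) fun h => hx (.inr h)
  have hWharm : ∀ x ∉ A ∪ B,
      (r.adjoint μ hμ).generator ((r.adjoint μ hμ).hitProb A B) x = 0 := fun x hx =>
    (r.adjoint μ hμ).generator_hitProb A B (fun h => hx (.inl h)) fun h => hx (.inr h)
  have hVB := constOn_of_mem_boundaryFunctions hV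
  have hcap : (r.capacity μ A B : EReal) =
      ((-(r.adjoint μ hμ).form μ (r.hitProb A B) (r.hitProb A B) : ℝ) : EReal) := by
    rw [r.capacity_eq hr μ hAB hB, EReal.coe_ennreal_ofReal,
      ← form_eq_form_adjoint hμ hpos hB hVB hVB]
    -- The truncation at zero in `ENNReal.ofReal` is harmless since the energy is nonnegative.
    exact congrArg _ (max_eq_left (neg_nonneg.2 (form_self_nonpos hμ hpos hB hVB)))
  have hattained := supFunctional_average hμ hpos hB hV hW hVharm hWharm
  rw [hcap]
  refine ⟨fun F hF H hH => ⟨?_, ?_⟩, le_antisymm (le_iInf₂ fun F hF => ?_) ?_,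
    average_mem_boundaryFunctions hV hW, hattained, fun hne F hF hsup => ?_⟩
  · exact summable_weighted_generator hμ' hB (constOn_of_mem_boundaryFunctions hF) hH.2
  · exact summable_weighted_symmGenerator hμ hpos hB hH.2
  · exact le_supFunctional hμ hpos hB hV hVharm hF
  · exact iInf₂_le_of_le _ (average_mem_boundaryFunctions hV hW) hattained.le
  · exact eq_average_of_supFunctional_le hμ hpos hr hB hne hV hW hVharm hWharm hF hsup.le
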